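/- Setting. There are $K$ independent data streams; stream $k\in[K]=\{1,\dots,K\}$ consists of i.i.d. observations $X^k_1,X^k_2,\dots$ in a measurable space $\mathcal X^k$ whose common density with respect to a $\sigma$-finite measure $\mu^k$ is $f_0^k$ (noise) or $f_1^k$ (signal). Assume that for every $k$ and $(i,i')\in\{(0,1),(1,0)\}$ $$\int \log\bigl(f_i^k/f_{i'}^k\bigr) f_i^k\,d\mu^k>0,\qquad \int \bigl[\log\bigl(f_i^k/f_{i'}^k\bigr)\bigr]^2 f_i^k\,d\mu^k<\infty .$$ For $A\subset[K]$ let $\mathbb P_A$ (with expectation $\mathbb E_A$) be the law of all observations when exactly the streams in $A$ are signals, and let $f_A(x)=\prod_{k\in A}f_1^k(x^k)\prod_{k\notin A}f_0^k(x^k)$ be the density of the vector $\mathbf X_t=(X_t^1,\dots,X_t^K)$. Let $\mathcal A$ be a collection of subsets of $[K]$ (the possible signal subsets) and $\mathcal F_t=\sigma(\mathbf X_1,\dots,\mathbf X_t)$. A procedure is a pair $\delta=(T,D)$ of an $(\mathcal F_t)$-stopping time $T$ with values in $\{0,1,2,\dots\}\cup\{\infty\}$ and an $\mathcal F_T$-measurable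 decision $D\in\mathcal A$; $\Delta$ is the set of all procedures. For $\Delta'\subset\Delta$ put $T_A^{\min}(\Delta')=\inf_{(T,D)\in\Delta'}\mathbb E_A[T]$. For a loss $\mathcal W(\cdot\mid\cdot):\mathcal A\times\mathcal A\to[0,\infty)$ with $\mathcal W(A\mid A)=0$ for all $A\in\mathcal A$, and $c>0$, put $$\mathrm{ERR}(\delta;\mathcal W)=\frac1{|\mathcal A|}\sum_{A\in\mathcal A}\sum_{d\in\mathcal A}\mathbb P_A(D=d)\,\mathcal W(d\mid A),\qquad \pi_t(A)=\frac{\prod_{s\le t}f_A(\mathbf X_s)}{\sum_{B\in\mathcal A}\prod_{s\le t}f_B(\mathbf X_s)},$$ $$T_{\mathrm{Ld}}(c,\mathcal W)=\min\Bigl\{t\ge1:\ \min_{D\in\mathcal A}\sum_{A\in\mathcal A}\pi_t(A)\,\mathcal W(D\mid A)<c\Bigr\}\qquad(\min\emptyset=\infty).$$ Theorem. Let $\mathcal W$ be such a loss, with $\max_{A\in\mathcal A}\mathcal W(D\mid A)>0$ for every $D\in\mathcal A$. Then there is a constant $M>0$, depending only on the model (the spaces $\mathcal X^k$, the measures $\mu^k$,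 the densities $f_i^k$, and $\mathcal A$) and on $\mathcal W$, with the following property. Let $r\ge1$, and for every $\theta\in(0,1)^r$ let $\Delta(\theta)\subset\Delta$, $\delta_0(\theta)=(T_0(\theta),D_0(\theta))\in\Delta(\theta)$ and $c_\theta>0$; let $L>0$; and suppose that for every $\theta\in(0,1)^r$ 1. $T_0(\theta)\le T_{\mathrm{Ld}}(c_\theta,\mathcal W)$ holds $\mathbb P_A$-almost surely for every $A\in\mathcal A$; 2. $\mathrm{ERR}(\delta;\mathcal W)\le L\,c_\theta$ for every $\delta\in\Delta(\theta)$. Then, for all $A\in\mathcal A$ and all $\theta\in(0,1)^r$, $\mathbb E_A[T_0(\theta)]<\infty$ and $$\mathbb E_A[T_0(\theta)]-T_A^{\min}(\Delta(\theta))\le(2L+M)\,|\mathcal A| .$$ Consequently $\{\delta_0(\theta)\}$ is second-order asymptotically optimal in $\{\Delta(\theta)\}$: for every $A\in\mathcal A$, $\mathbb E_A[T_0(\theta)]$ is finite for $\theta\in(0,1)^r$ near $0$, and $\limsup_{\theta\to0}\bigl(\mathbb E_A[T_0(\theta)]-T_A^{\min}(\Delta(\theta))\bigr)<\infty$. -/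

import Mathlib

open MeasureTheory Filter Topology
open scoped ENNReal NNReal

noncomputable section

namespace SeqTest

/-- `K` data streams with simple hypotheses. For every stream `k` there is a σ-finite reference
measure `μ k` and two probability densities with respect to it: `f 0 k` under the null hypothesis
and `f 1 k` under the alternative. -/
structure Model (K : ℕ) (𝒳 : Fin K → Type*) [∀ k, MeasurableSpace (𝒳 k)] where
  μ : ∀ k, Measure (𝒳 k)
  sigmaFinite : ∀ k, SigmaFinite (μ k)
  f : Fin 2 → ∀ k, 𝒳 k → ℝ≥0
  measurable_f : ∀ i k, Measurable (f i k)
  lintegral_f : ∀ i k, ∫⁻ x, (f i k x : ℝ≥0∞) ∂(μ k) = 1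

/-- The sample space of the observations. The value `ω s` is the vector of the observations of all
streams at time `s + 1`; that is, `ω 0, ω 1, …` are the observations at times `1, 2, …`. -/
abbrev Obs {K : ℕ} (𝒳 : Fin K → Type*) : Type _ := ℕ → ∀ k, 𝒳 k

section Procedures

variable {K : ℕ} (𝒳 : Fin K → Type*) [∀ k, MeasurableSpace (𝒳 k)]

/-- The σ-field at time `t` is generated by the first `t` vectors of observations; it is trivial
for `t = 0`. -/
def obsFiltration : Filtration ℕ (inferInstance : MeasurableSpace (Obs 𝒳)) where
  seq t := ⨆ s : Fin t, MeasurableSpace.comap (fun ω : Obs 𝒳 => ω s) inferInstance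
  mono' _ _ hij := iSup_le fun s =>
    le_iSup (fun s : Fin _ => MeasurableSpace.comap (fun ω : Obs 𝒳 => ω s) inferInstance)
      (Fin.castLE hij s)
  le' _ := iSup_le fun s => (measurable_pi_apply (s : ℕ)).comap_le

/-- A sequential multiple testing procedure `(T, D)`: an extended-integer-valued stopping time `T`
and an `ℱ_T`-measurable decision `D` with values in the class `𝒜` of possible signal subsets
(`D` is identified with the set of the streams that are declared to be signals). -/
structure Procedure (𝒜 : Finset (Finset (Fin K))) where
  T : Obs 𝒳 → ℕ∞
  D : Obs 𝒳 → 𝒜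
  isStoppingTime : IsStoppingTime (obsFiltration 𝒳) T
  measurable_D : ∀ d : 𝒜, MeasurableSet[isStoppingTime.measurableSpace] {ω | D ω = d}

end Procedures

namespace Model

variable {K : ℕ} {𝒳 : Fin K → Type*} [∀ k, MeasurableSpace (𝒳 k)] (m : Model K 𝒳)

/-- Kullback-Leibler divergences are positive, and the log-likelihood ratios have finite second
moments, under both hypotheses. In the second-moment condition the logarithm takes values in
`[-∞, ∞]`, with `log (a / 0) = ∞` for `a > 0` (and the integrand is zero where `f i k` is zero);
under this condition the real logarithm is equal to it almost everywhere in the first one. -/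
def MomentAssumption : Prop :=
  ∀ k, ∀ i j : Fin 2, i ≠ j →
    0 < ∫ x, Real.log ((m.f i k x : ℝ) / (m.f j k x : ℝ)) * (m.f i k x : ℝ) ∂(m.μ k) ∧
    ∫⁻ x, (ENNReal.log ((m.f i k x : ℝ≥0∞) / (m.f j k x : ℝ≥0∞))).abs ^ 2 * (m.f i k x : ℝ≥0∞)
      ∂(m.μ k) < ∞

/-- The law of a single observation of stream `k` under its null (`i = 0`) or alternative
(`i = 1`) hypothesis. -/
def streamLaw (i : Fin 2) (k : Fin K) : Measure (𝒳 k) :=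
  (m.μ k).withDensity fun x => (m.f i k x : ℝ≥0∞)

/-- The law of the vector of observations at a single time, when `A` is the signal subset. -/
def obsLaw (A : Finset (Fin K)) : Measure (∀ k, 𝒳 k) :=
  Measure.pi fun k => m.streamLaw (if k ∈ A then 1 else 0) k

/-- The law of all observations when `A` is the signal subset: observations are independent
across streams and times. -/
def law (A : Finset (Fin K)) : Measure (Obs 𝒳) :=
  Measure.infinitePi fun _ : ℕ => m.obsLaw A

instance isProbabilityMeasure_streamLaw (i : Fin 2) (k : Fin K) :
    IsProbabilityMeasure (m.streamLaw i k) :=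
  ⟨by rw [streamLaw, withDensity_apply _ MeasurableSet.univ, Measure.restrict_univ,
    m.lintegral_f i k]⟩

instance isProbabilityMeasure_obsLaw (A : Finset (Fin K)) :
    IsProbabilityMeasure (m.obsLaw A) := by
  unfold obsLaw; infer_instance

instance isProbabilityMeasure_law (A : Finset (Fin K)) :
    IsProbabilityMeasure (m.law A) := by
  unfold law; infer_instance

/-- The joint density of the vector of observations at a single time. -/
def density (A : Finset (Fin K)) (x : ∀ k, 𝒳 k) : ℝ≥0 :=
  (∏ k ∈ A, m.f 1 k (x k)) * ∏ k ∈ Aᶜ, m.f 0 k (x k)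

/-- The likelihood of `A` based on the observations up to time `t`. -/
def likelihood (A : Finset (Fin K)) (t : ℕ) (ω : Obs 𝒳) : ℝ≥0 :=
  ∏ s ∈ Finset.range t, m.density A (ω s)

variable {𝒜 : Finset (Finset (Fin K))}

/-- The posterior probability of `A` at time `t`, for the uniform prior on `𝒜`. -/
def posterior (t : ℕ) (ω : Obs 𝒳) (A : 𝒜) : ℝ≥0 :=
  m.likelihood A t ω / ∑ B : 𝒜, m.likelihood B t ω

/-- The posterior expected loss at time `t` of the decision `D`. Here and below, `W D A` is the
loss of deciding `D` when the signal subset is `A`. -/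
def posteriorLoss (W : 𝒜 → 𝒜 → ℝ≥0) (t : ℕ) (ω : Obs 𝒳) (D : 𝒜) : ℝ≥0 :=
  ∑ A : 𝒜, m.posterior t ω A * W D A

/-- Lorden's stopping time with cost `c`: the first `t ≥ 1` at which some decision has posterior
expected loss less than `c` (and `∞` if there is no such `t`). -/
def lordenTime (c : ℝ) (W : 𝒜 → 𝒜 → ℝ≥0) (ω : Obs 𝒳) : ℕ∞ :=
  sInf {τ : ℕ∞ | ∃ t : ℕ, τ = t ∧ 1 ≤ t ∧ ∃ D : 𝒜, (m.posteriorLoss W t ω D : ℝ) < c}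

/-- The expected sample size of a procedure when `A` is the signal subset. -/
def ess (A : 𝒜) (δ : Procedure 𝒳 𝒜) : ℝ≥0∞ :=
  ∫⁻ ω, (δ.T ω : ℝ≥0∞) ∂(m.law A)

/-- The minimal achievable expected sample size over a class of procedures. -/
def minEss (A : 𝒜) (Δ : Set (Procedure 𝒳 𝒜)) : ℝ≥0∞ :=
  ⨅ δ ∈ Δ, m.ess A δ

/-- The integrated error loss of a procedure, for the uniform prior on `𝒜`. -/
def integratedError (δ : Procedure 𝒳 𝒜) (W : 𝒜 → 𝒜 → ℝ≥0) : ℝ :=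
  ∑ A : 𝒜, (1 / (𝒜.card : ℝ)) * ∑ d : 𝒜, (m.law A).real {ω | δ.D ω = d} * (W d A : ℝ)

end Model

/-- The set `(0, 1)^r` of error tolerance vectors. -/
def tolerances (r : ℕ) : Set (Fin r → ℝ) := {θ | ∀ j, θ j ∈ Set.Ioo (0 : ℝ) 1}

/-- The procedures `δ θ ∈ Δ θ` are second-order asymptotically optimal: for every `A`, the limit
superior, as `θ → 0`, of the difference between the expected sample size of `δ θ` and the minimal
one over `Δ θ` is less than `∞`. The expected sample sizes are required to be finite for `θ` near
`0`, so that the difference makes sense. -/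
def IsSecondOrderOptimal {K : ℕ} {𝒳 : Fin K → Type*} [∀ k, MeasurableSpace (𝒳 k)]
    (m : Model K 𝒳) {𝒜 : Finset (Finset (Fin K))} {r : ℕ}
    (Δ : (Fin r → ℝ) → Set (Procedure 𝒳 𝒜)) (δ : (Fin r → ℝ) → Procedure 𝒳 𝒜) : Prop :=
  (∀ θ ∈ tolerances r, δ θ ∈ Δ θ) ∧
  ∀ A : 𝒜, (∀ᶠ θ in 𝓝[tolerances r] 0, m.ess A (δ θ) < ∞) ∧
    limsup (fun θ => (m.ess A (δ θ) : EReal) - (m.minEss A (Δ θ) : EReal))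
      (𝓝[tolerances r] 0) < ⊤

end SeqTest

end

namespace SeqTest

section ProductMeasures

theorem lintegral_fin_prod_eq_prod {n : ℕ} {E : Fin n → Type*}
    {mE : ∀ i, MeasurableSpace (E i)} {μ : (i : Fin n) → Measure (E i)} [∀ i, SigmaFinite (μ i)]
    (f : (i : Fin n) → E i → ℝ≥0∞) (hf : ∀ i, Measurable (f i)) :
    ∫⁻ x : (i : Fin n) → E i, ∏ i, f i (x i) ∂(Measure.pi μ) = ∏ i, ∫⁻ x, f i x ∂(μ i) := by
  induction n with
  | zero => simp
  | succ n ih =>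
    have hF : Measurable fun x : (i : Fin (n + 1)) → E i => ∏ i, f i (x i) := by fun_prop
    calc ∫⁻ x : (i : Fin (n + 1)) → E i, ∏ i, f i (x i) ∂(Measure.pi μ)
        = ∫⁻ x : E 0 × ((i : Fin n) → E i.succ), f 0 x.1 * ∏ i : Fin n, f i.succ (x.2 i)
            ∂((μ 0).prod (Measure.pi fun i => μ i.succ)) := by
          rw [← ((measurePreserving_piFinSuccAbove μ 0).symm).lintegral_comp hF]
          refine lintegral_congr fun x => ?_
          rw [Fin.prod_univ_succ]
          rfl
      _ = ∏ i, ∫⁻ x, f i x ∂(μ i) := by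
          rw [lintegral_prod_mul (f := f 0)
            (g := fun y : (i : Fin n) → E i.succ => ∏ i : Fin n, f i.succ (y i))
            (hf 0).aemeasurable (Finset.measurable_fun_prod _ fun i _ =>
              (hf i.succ).comp (measurable_pi_apply i)).aemeasurable,
            ih _ fun i => hf i.succ, Fin.prod_univ_succ]

/-- Tonelli's theorem for a product of functions of the single coordinates. -/
theorem lintegral_fintype_prod_eq_prod {ι : Type*} [Fintype ι] {E : ι → Type*}
    {mE : ∀ i, MeasurableSpace (E i)} {μ : (i : ι) → Measure (E i)} [∀ i, SigmaFinite (μ i)]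
    (f : (i : ι) → E i → ℝ≥0∞) (hf : ∀ i, Measurable (f i)) :
    ∫⁻ x : (i : ι) → E i, ∏ i, f i (x i) ∂(Measure.pi μ) = ∏ i, ∫⁻ x, f i x ∂(μ i) := by
  let e := (Fintype.equivFin ι).symm
  have hF : Measurable fun x : (i : ι) → E i => ∏ i, f i (x i) := by fun_prop
  rw [← (measurePreserving_piCongrLeft _ e).lintegral_comp hF]
  simp_rw [← e.prod_comp, MeasurableEquiv.coe_piCongrLeft, Equiv.piCongrLeft_apply_apply]
  exact lintegral_fin_prod_eq_prod _ fun i => hf _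

theorem pi_withDensity {ι : Type*} [Fintype ι] {E : ι → Type*}
    {mE : ∀ i, MeasurableSpace (E i)} {μ : (i : ι) → Measure (E i)} [∀ i, SigmaFinite (μ i)]
    (f : (i : ι) → E i → ℝ≥0∞) (hf : ∀ i, Measurable (f i))
    [∀ i, SigmaFinite ((μ i).withDensity (f i))] :
    Measure.pi (fun i => (μ i).withDensity (f i))
      = (Measure.pi μ).withDensity fun x => ∏ i, f i (x i) := by
  refine (Measure.pi_eq fun s hs => ?_)
  rw [withDensity_apply _ (MeasurableSet.univ_pi hs), Measure.restrict_pi_pi,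
    lintegral_fintype_prod_eq_prod f hf]
  exact Finset.prod_congr rfl fun i _ => (withDensity_apply _ (hs i)).symm

variable {X : Type*} [MeasurableSpace X] {ν : Measure X}

theorem nnreal_le_sqrt_mul_sqrt {a b z : ℝ≥0} (h : b ≤ z * a) :
    b ≤ NNReal.sqrt z * NNReal.sqrt (a * b) := by
  rw [← NNReal.sqrt_mul, NNReal.le_sqrt_iff_sq_le, sq, ← mul_assoc]
  gcongr

theorem nnreal_sqrt_mul_sqrt_le {a b p q z : ℝ≥0} (hz : z ≤ p * q) :
    NNReal.sqrt z * NNReal.sqrt (a * b) ≤ p * a + q * b := by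
  rw [← NNReal.sqrt_mul, NNReal.sqrt_le_iff_le_sq]
  calc z * (a * b) ≤ p * q * (a * b) := by gcongr
    _ = p * a * (q * b) := by ring
    _ ≤ (p * a) ^ 2 + 2 * (p * a) * (q * b) + (q * b) ^ 2 := by
      rw [← add_sq, sq]
      gcongr <;> simp
    _ = (p * a + q * b) ^ 2 := (add_sq _ _).symm

theorem nnreal_prod_sqrt {ι : Type*} (s : Finset ι) (f : ι → ℝ≥0) :
    ∏ i ∈ s, NNReal.sqrt (f i) = NNReal.sqrt (∏ i ∈ s, f i) := by
  induction s using Finset.cons_induction with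
  | empty => simp
  | cons i s hi ih => rw [Finset.prod_cons, Finset.prod_cons, NNReal.sqrt_mul, ih]

/-- The Hellinger affinity of two densities. -/
noncomputable def affinity (ν : Measure X) (a b : X → ℝ≥0) : ℝ≥0∞ :=
  ∫⁻ x, (NNReal.sqrt (a x * b x) : ℝ≥0∞) ∂ν

theorem nnreal_sqrt_mul_le_half (a b : ℝ≥0) : NNReal.sqrt (a * b) ≤ (a + b) / 2 := by
  rw [NNReal.sqrt_le_iff_le_sq, ← NNReal.coe_le_coe]
  push_cast
  nlinarith [sq_nonneg ((a : ℝ) - b)]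

theorem eq_of_nnreal_sqrt_mul_eq_half {a b : ℝ≥0} (h : NNReal.sqrt (a * b) = (a + b) / 2) :
    a = b := by
  rw [NNReal.sqrt_eq_iff_eq_sq, ← NNReal.coe_inj] at h
  push_cast at h
  have h0 : ((a : ℝ) - b) ^ 2 = 0 := by linarith
  exact NNReal.coe_injective (sub_eq_zero.1 (pow_eq_zero_iff two_ne_zero |>.1 h0))

theorem lintegral_half_add_eq_one {a b : X → ℝ≥0} (ha : Measurable a)
    (ha1 : ∫⁻ x, (a x : ℝ≥0∞) ∂ν = 1) (hb1 : ∫⁻ x, (b x : ℝ≥0∞) ∂ν = 1) :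
    ∫⁻ x, (((a x + b x) / 2 : ℝ≥0) : ℝ≥0∞) ∂ν = 1 := by
  simp_rw [div_eq_mul_inv, ENNReal.coe_mul, ENNReal.coe_add]
  rw [lintegral_mul_const' _ _ ENNReal.coe_ne_top, lintegral_add_left ha.coe_nnreal_ennreal,
    ha1, hb1, one_add_one_eq_two, ENNReal.coe_inv two_ne_zero]
  exact ENNReal.mul_inv_cancel two_ne_zero ENNReal.ofNat_ne_top

theorem affinity_le_one {a b : X → ℝ≥0} (ha : Measurable a)
    (ha1 : ∫⁻ x, (a x : ℝ≥0∞) ∂ν = 1) (hb1 : ∫⁻ x, (b x : ℝ≥0∞) ∂ν = 1) :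
    affinity ν a b ≤ 1 := by
  rw [← lintegral_half_add_eq_one ha ha1 hb1]
  exact lintegral_mono fun x => ENNReal.coe_le_coe.2 (nnreal_sqrt_mul_le_half _ _)

theorem affinity_lt_one {a b : X → ℝ≥0} (ha : Measurable a) (hb : Measurable b)
    (ha1 : ∫⁻ x, (a x : ℝ≥0∞) ∂ν = 1) (hb1 : ∫⁻ x, (b x : ℝ≥0∞) ∂ν = 1)
    (hab : ¬ a =ᵐ[ν] b) : affinity ν a b < 1 := by
  refine (affinity_le_one ha ha1 hb1).lt_of_ne fun h => hab ?_
  have hle : ∀ x, (NNReal.sqrt (a x * b x) : ℝ≥0∞) ≤ (((a x + b x) / 2 : ℝ≥0) : ℝ≥0∞) :=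
    fun x => ENNReal.coe_le_coe.2 (nnreal_sqrt_mul_le_half _ _)
  have heq := ae_eq_of_ae_le_of_lintegral_le (μ := ν) (Eventually.of_forall hle)
    (h.trans_ne ENNReal.one_ne_top) (by fun_prop)
    ((lintegral_half_add_eq_one ha ha1 hb1).trans h.symm).le
  filter_upwards [heq] with x hx
  exact eq_of_nnreal_sqrt_mul_eq_half (ENNReal.coe_injective hx)

variable [SigmaFinite ν]

theorem infinitePi_withDensity_preimage_restrict {f : X → ℝ≥0∞} (hf : Measurable f)
    [IsProbabilityMeasure (ν.withDensity f)] {I : Finset ℕ} {S : Set (I → X)}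
    (hS : MeasurableSet S) :
    Measure.infinitePi (fun _ : ℕ => ν.withDensity f) (I.restrict ⁻¹' S)
      = ∫⁻ y in S, ∏ i, f (y i) ∂Measure.pi fun _ : I => ν := by
  rw [← Measure.map_apply (Finset.measurable_restrict I) hS, Measure.infinitePi_map_restrict,
    pi_withDensity _ fun _ => hf, withDensity_apply _ hS]

theorem setLIntegral_prod_of_preimage_restrict_eq [Nonempty X] {g : X → ℝ≥0∞} (hg : Measurable g)
    (hg_top : ∫⁻ x, g x ∂ν ≠ ∞) {I J : Finset ℕ} (hJI : J ⊆ I) {R : Set (J → X)} {S : Set (I → X)}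
    (hR : MeasurableSet R) (hS : MeasurableSet S)
    (h : (I.restrict ⁻¹' S : Set (ℕ → X)) = J.restrict ⁻¹' R) :
    ∫⁻ y in S, ∏ i, g (y i) ∂(Measure.pi fun _ : I => ν)
      = (∫⁻ x, g x ∂ν) ^ (I.card - J.card)
        * ∫⁻ y in R, ∏ i, g (y i) ∂(Measure.pi fun _ : J => ν) := by
  set ρ := ∫⁻ x, g x ∂ν with hρ
  have hcard := Finset.card_le_card hJI
  rcases eq_or_ne ρ 0 with h0 | h0
  · have hle : ∀ (L : Finset ℕ), L.card ≠ 0 → ∀ (Z : Set (L → X)),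
        ∫⁻ y in Z, ∏ i, g (y i) ∂(Measure.pi fun _ : L => ν) = 0 := by
      intro L hL Z
      refine le_antisymm ((setLIntegral_le_lintegral _ _).trans ?_) zero_le
      rw [lintegral_fintype_prod_eq_prod _ fun _ => hg, ← hρ, h0]
      simp [hL]
    rcases hcard.lt_or_eq with hlt | heq
    · rw [hle I (by omega), h0, zero_pow (by omega), zero_mul]
    · obtain rfl := Finset.eq_of_subset_of_card_le hJI heq.ge
      have hsurj : Function.Surjective (Finset.restrict (π := fun _ => X) J) := fun y =>
        ⟨fun n => if hn : n ∈ J then y ⟨n, hn⟩ else Classical.arbitrary X, by ext i; simp⟩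
      rw [hsurj.preimage_injective h, Nat.sub_self, pow_zero, one_mul]
  · have hQ : IsProbabilityMeasure (ν.withDensity fun x => ρ⁻¹ * g x) := by
      refine ⟨?_⟩
      rw [withDensity_apply _ MeasurableSet.univ, Measure.restrict_univ,
        lintegral_const_mul _ hg, ENNReal.inv_mul_cancel h0 hg_top]
    have key : ∀ (L : Finset ℕ) (Z : Set (L → X)), MeasurableSet Z →
        ∫⁻ y in Z, ∏ i, g (y i) ∂(Measure.pi fun _ : L => ν) = ρ ^ L.card *
          Measure.infinitePi (fun _ : ℕ => ν.withDensity fun x => ρ⁻¹ * g x)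
            (L.restrict ⁻¹' Z) := by
      intro L Z hZ
      rw [infinitePi_withDensity_preimage_restrict (by fun_prop) hZ]
      simp_rw [Finset.prod_mul_distrib]
      rw [lintegral_const_mul _ (by fun_prop), ← mul_assoc]
      simp only [Finset.prod_const, Finset.card_univ, Fintype.card_coe]
      rw [← mul_pow, ENNReal.mul_inv_cancel h0 hg_top, one_pow, one_mul]
    rw [key I S hS, key J R hR, h, ← mul_assoc, ← pow_add, Nat.sub_add_cancel hcard]

/-- On a cylinder set over the coordinates in `J`, the probability under the density `b` that the
likelihood of `b` over `I ⊇ J` is at most `z` times that of `a` decays geometrically in the number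
of additional coordinates. -/
theorem infinitePi_inter_likelihood_le [Nonempty X] {a b : X → ℝ≥0} (ha : Measurable a)
    (hb : Measurable b) [IsProbabilityMeasure (ν.withDensity fun x => (a x : ℝ≥0∞))]
    [IsProbabilityMeasure (ν.withDensity fun x => (b x : ℝ≥0∞))]
    (hab : affinity ν a b ≠ ∞)
    {I J : Finset ℕ} (hJI : J ⊆ I) {R : Set (J → X)} (hR : MeasurableSet R) {p q z : ℝ≥0}
    (hz : z ≤ p * q) :
    Measure.infinitePi (fun _ : ℕ => ν.withDensity fun x => (b x : ℝ≥0∞))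
      (J.restrict ⁻¹' R ∩ {ω : ℕ → X |
        ∏ i ∈ I, b (ω i) ≤ z * ∏ i ∈ I, a (ω i)})
      ≤ affinity ν a b ^ (I.card - J.card) *
        (p * Measure.infinitePi (fun _ : ℕ => ν.withDensity fun x => (a x : ℝ≥0∞))
            (J.restrict ⁻¹' R) +
          q * Measure.infinitePi (fun _ : ℕ => ν.withDensity fun x => (b x : ℝ≥0∞))
            (J.restrict ⁻¹' R)) := by
  set S : Set (I → X) := Finset.restrict₂ (π := fun _ => X) hJI ⁻¹' R with hS
  have hSm : MeasurableSet S := (Finset.measurable_restrict₂ hJI) hR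
  have hSR : (I.restrict ⁻¹' S : Set (ℕ → X)) = J.restrict ⁻¹' R := by
    rw [hS, ← Set.preimage_comp, Finset.restrict₂_comp_restrict]
  set S' : Set (I → X) := S ∩ {y | ∏ i, b (y i) ≤ z * ∏ i, a (y i)} with hS'
  have hS'm : MeasurableSet S' :=
    hSm.inter (measurableSet_le (by fun_prop) (by fun_prop))
  have hset : J.restrict ⁻¹' R ∩ {ω : ℕ → X |
      ∏ i ∈ I, b (ω i) ≤ z * ∏ i ∈ I, a (ω i)} = I.restrict ⁻¹' S' := by
    rw [hS', Set.preimage_inter, hSR]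
    congr 1
    ext ω
    simp [Finset.prod_attach I fun i => b (ω i), Finset.prod_attach I fun i => a (ω i)]
  have hg : Measurable fun x => (NNReal.sqrt (a x * b x) : ℝ≥0∞) := by fun_prop
  rw [hset, infinitePi_withDensity_preimage_restrict (by fun_prop) hS'm,
    infinitePi_withDensity_preimage_restrict (by fun_prop) hR,
    infinitePi_withDensity_preimage_restrict (by fun_prop) hR]
  calc ∫⁻ y in S', ∏ i, (b (y i) : ℝ≥0∞) ∂(Measure.pi fun _ : I => ν)
      ≤ ∫⁻ y in S', NNReal.sqrt z * ∏ i, (NNReal.sqrt (a (y i) * b (y i)) : ℝ≥0∞)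
          ∂(Measure.pi fun _ : I => ν) := by
        refine setLIntegral_mono' hS'm fun y hy => ?_
        simp_rw [← ENNReal.ofNNReal_finsetProd, ← ENNReal.coe_mul, ENNReal.coe_le_coe,
          nnreal_prod_sqrt, Finset.prod_mul_distrib]
        exact nnreal_le_sqrt_mul_sqrt hy.2
    _ ≤ ∫⁻ y in S, NNReal.sqrt z * ∏ i, (NNReal.sqrt (a (y i) * b (y i)) : ℝ≥0∞)
          ∂(Measure.pi fun _ : I => ν) := lintegral_mono_set Set.inter_subset_left
    _ = affinity ν a b ^ (I.card - J.card) *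
          ∫⁻ y in R, NNReal.sqrt z * ∏ i, (NNReal.sqrt (a (y i) * b (y i)) : ℝ≥0∞)
          ∂(Measure.pi fun _ : J => ν) := by
        rw [lintegral_const_mul' _ _ ENNReal.coe_ne_top, lintegral_const_mul' _ _ ENNReal.coe_ne_top,
          setLIntegral_prod_of_preimage_restrict_eq hg hab hJI hR hSm hSR]
        simp only [affinity]
        ring
    _ ≤ affinity ν a b ^ (I.card - J.card) *
          ∫⁻ y in R, (p * ∏ i, (a (y i) : ℝ≥0∞) + q * ∏ i, (b (y i) : ℝ≥0∞))
          ∂(Measure.pi fun _ : J => ν) := by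
        gcongr with y
        simp_rw [← ENNReal.ofNNReal_finsetProd, ← ENNReal.coe_mul, ← ENNReal.coe_add,
          ENNReal.coe_le_coe, nnreal_prod_sqrt, Finset.prod_mul_distrib]
        exact nnreal_sqrt_mul_sqrt_le hz
    _ = _ := by
        rw [lintegral_add_left (by fun_prop), lintegral_const_mul' _ _ ENNReal.coe_ne_top,
          lintegral_const_mul' _ _ ENNReal.coe_ne_top]

end ProductMeasures

theorem exists_preimage_restrict_of_measurableSet_obsFiltration {K : ℕ} {𝒳 : Fin K → Type*}
    [∀ k, MeasurableSpace (𝒳 k)] {t : ℕ} {E : Set (Obs 𝒳)}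
    (hE : MeasurableSet[obsFiltration 𝒳 t] E) :
    ∃ R : Set (Finset.range t → ∀ k, 𝒳 k), MeasurableSet R ∧
      (Finset.range t).restrict ⁻¹' R = E := by
  have hle : (obsFiltration 𝒳 t : MeasurableSpace (Obs 𝒳))
      ≤ MeasurableSpace.comap (Finset.range t).restrict inferInstance := by
    refine iSup_le fun s => ?_
    have h : (fun ω : Obs 𝒳 => ω s)
        = (fun y : Finset.range t → ∀ k, 𝒳 k => y ⟨s, Finset.mem_range.2 s.2⟩) ∘
          (Finset.range t).restrict := rfl
    rw [h, ← MeasurableSpace.comap_comp]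
    exact MeasurableSpace.comap_mono (measurable_pi_apply _).comap_le
  exact hle E hE

namespace Model

variable {K : ℕ} {𝒳 : Fin K → Type*} [∀ k, MeasurableSpace (𝒳 k)] (m : Model K 𝒳)

instance sigmaFinite_reference (k : Fin K) : SigmaFinite (m.μ k) := m.sigmaFinite k

theorem density_eq_prod (A : Finset (Fin K)) (x : ∀ k, 𝒳 k) :
    m.density A x = ∏ k, m.f (if k ∈ A then 1 else 0) k (x k) := by
  rw [density, ← Finset.prod_mul_prod_compl A]
  congr 1
  · exact Finset.prod_congr rfl fun k hk => by rw [if_pos hk]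
  · exact Finset.prod_congr rfl fun k hk => by rw [if_neg (Finset.mem_compl.1 hk)]

theorem measurable_density (A : Finset (Fin K)) : Measurable (m.density A) := by
  have h := fun i k => m.measurable_f i k
  unfold density
  fun_prop

theorem obsLaw_eq_withDensity (A : Finset (Fin K)) :
    m.obsLaw A = (Measure.pi m.μ).withDensity fun x => (m.density A x : ℝ≥0∞) := by
  have hprob : ∀ k, IsProbabilityMeasure
      ((m.μ k).withDensity fun x => (m.f (if k ∈ A then 1 else 0) k x : ℝ≥0∞)) :=
    fun k => m.isProbabilityMeasure_streamLaw _ k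
  simp_rw [density_eq_prod, ENNReal.ofNNReal_finsetProd]
  exact pi_withDensity (μ := m.μ) (fun k x => (m.f (if k ∈ A then 1 else 0) k x : ℝ≥0∞))
    fun k => (m.measurable_f _ k).coe_nnreal_ennreal

instance isProbabilityMeasure_withDensity_density (A : Finset (Fin K)) :
    IsProbabilityMeasure ((Measure.pi m.μ).withDensity fun x => (m.density A x : ℝ≥0∞)) := by
  rw [← obsLaw_eq_withDensity]; infer_instance

theorem lintegral_density (A : Finset (Fin K)) :
    ∫⁻ x, (m.density A x : ℝ≥0∞) ∂(Measure.pi m.μ) = 1 := by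
  have h := (m.isProbabilityMeasure_withDensity_density A).measure_univ
  rwa [withDensity_apply _ MeasurableSet.univ, Measure.restrict_univ] at h

theorem law_eq_infinitePi_withDensity (A : Finset (Fin K)) :
    m.law A = Measure.infinitePi fun _ : ℕ =>
      (Measure.pi m.μ).withDensity fun x => (m.density A x : ℝ≥0∞) := by
  unfold law
  simp_rw [obsLaw_eq_withDensity]

theorem nonempty_observation (m : Model K 𝒳) : Nonempty (∀ k, 𝒳 k) :=
  (m.obsLaw ∅).nonempty_of_neZero

variable {m}

theorem MomentAssumption.streamLaw_ne (hm : m.MomentAssumption) (k : Fin K) :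
    m.streamLaw 1 k ≠ m.streamLaw 0 k := by
  intro h
  have hae := (withDensity_eq_iff (m.measurable_f 1 k).coe_nnreal_ennreal.aemeasurable
    (m.measurable_f 0 k).coe_nnreal_ennreal.aemeasurable
    ((m.lintegral_f 1 k).trans_ne ENNReal.one_ne_top)).1 h
  refine (hm k 1 0 one_ne_zero).1.ne' (integral_eq_zero_of_ae ?_)
  filter_upwards [hae] with x hx
  rw [ENNReal.coe_injective hx]
  rcases eq_or_ne (m.f 0 k x : ℝ) 0 with h0 | h0
  · simp [h0]
  · simp [div_self h0]

theorem MomentAssumption.obsLaw_injective (hm : m.MomentAssumption) :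
    Function.Injective m.obsLaw := by
  intro A B h
  ext k
  have hk := congrArg (Measure.map fun x : ∀ k, 𝒳 k => x k) h
  simp only [obsLaw] at hk
  rw [(measurePreserving_eval _ k).map_eq, (measurePreserving_eval _ k).map_eq] at hk
  by_cases hA : k ∈ A <;> by_cases hB : k ∈ B <;> simp only [hA, hB, if_true, if_false] at hk ⊢
  · exact (hm.streamLaw_ne k hk).elim
  · exact (hm.streamLaw_ne k hk.symm).elim

theorem MomentAssumption.affinity_density_lt_one (hm : m.MomentAssumption)
    {A B : Finset (Fin K)} (hAB : A ≠ B) :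
    affinity (Measure.pi m.μ) (m.density A) (m.density B) < 1 := by
  refine affinity_lt_one (m.measurable_density A) (m.measurable_density B)
    (m.lintegral_density A) (m.lintegral_density B) fun h => hAB (hm.obsLaw_injective ?_)
  rw [obsLaw_eq_withDensity, obsLaw_eq_withDensity]
  exact withDensity_congr_ae (h.fun_comp _)

variable (m)

/-- The likelihood of `B` at time `t` is at most `z` times that of `A`. -/
def likelihoodLe (A B : Finset (Fin K)) (z : ℝ≥0) (t : ℕ) : Set (Obs 𝒳) :=
  {ω | m.likelihood B t ω ≤ z * m.likelihood A t ω}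

theorem measurableSet_likelihoodLe (A B : Finset (Fin K)) (z : ℝ≥0) (t : ℕ) :
    MeasurableSet (m.likelihoodLe A B z t) := by
  have h := m.measurable_density
  unfold likelihoodLe likelihood
  exact measurableSet_le (by fun_prop) (by fun_prop)

theorem law_inter_likelihoodLe_le (A B : Finset (Fin K)) {j : ℕ} (s : ℕ) {E : Set (Obs 𝒳)}
    (hE : MeasurableSet[obsFiltration 𝒳 j] E) {p q z : ℝ≥0} (hz : z ≤ p * q) :
    m.law B (E ∩ m.likelihoodLe A B z (j + s))
      ≤ affinity (Measure.pi m.μ) (m.density A) (m.density B) ^ s *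
        (p * m.law A E + q * m.law B E) := by
  obtain ⟨R, hR, rfl⟩ := exists_preimage_restrict_of_measurableSet_obsFiltration hE
  have := m.nonempty_observation
  have h := infinitePi_inter_likelihood_le (ν := Measure.pi m.μ) (m.measurable_density A)
    (m.measurable_density B)
    ((affinity_le_one (m.measurable_density A) (m.lintegral_density A)
      (m.lintegral_density B)).trans_lt ENNReal.one_lt_top).ne
    (Finset.range_mono (Nat.le_add_right j s)) hR hz
  simp only [← law_eq_infinitePi_withDensity, Finset.card_range, Nat.add_sub_cancel_left] at h
  exact h

theorem tsum_law_inter_likelihoodLe_le (A B : Finset (Fin K)) {j : ℕ} {E : Set (Obs 𝒳)}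
    (hE : MeasurableSet[obsFiltration 𝒳 j] E) {p q z : ℝ≥0} (hz : z ≤ p * q) :
    ∑' s : ℕ, m.law B (E ∩ m.likelihoodLe A B z (j + (s + 1)))
      ≤ (1 - affinity (Measure.pi m.μ) (m.density A) (m.density B))⁻¹ *
        (p * m.law A E + q * m.law B E) := by
  rw [← ENNReal.tsum_geometric, ← ENNReal.tsum_mul_right]
  refine ENNReal.tsum_le_tsum fun s => (m.law_inter_likelihoodLe_le A B (s + 1) hE hz).trans ?_
  gcongr 1
  exact pow_le_pow_right_of_le_one' (affinity_le_one (m.measurable_density A)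
    (m.lintegral_density A) (m.lintegral_density B)) (Nat.le_succ s)

variable {𝒜 : Finset (Finset (Fin K))}

theorem exists_likelihood_le_of_le_posteriorLoss {W : 𝒜 → 𝒜 → ℝ≥0} {c : ℝ≥0} (hc : c ≠ 0) {t : ℕ}
    {ω : Obs 𝒳} {D : 𝒜} (h : c ≤ m.posteriorLoss W t ω D) (B : 𝒜) :
    ∃ A : 𝒜, ω ∈ m.likelihoodLe A B (𝒜.card * W D A / c) t := by
  set S := ∑ B : 𝒜, m.likelihood B t ω with hS
  have hS0 : S ≠ 0 := by
    intro h0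
    refine hc (le_antisymm (h.trans_eq ?_) zero_le)
    refine Finset.sum_eq_zero fun A _ => ?_
    rw [posterior, ← hS, h0, div_zero, zero_mul]
  have hn : (𝒜.card : ℝ≥0) ≠ 0 := by
    exact_mod_cast (Finset.card_pos.2 ⟨B.1, B.2⟩).ne'
  have hsum : c * S ≤ ∑ A : 𝒜, m.likelihood A t ω * W D A := by
    calc c * S ≤ m.posteriorLoss W t ω D * S := by gcongr
      _ = ∑ A : 𝒜, m.likelihood A t ω * W D A := by
        rw [posteriorLoss, Finset.sum_mul]
        refine Finset.sum_congr rfl fun A _ => ?_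
        rw [posterior, ← hS]
        field_simp
  have hB : m.likelihood B t ω ≤ S :=
    Finset.single_le_sum (f := fun B : 𝒜 => m.likelihood B t ω) (fun _ _ => zero_le)
      (Finset.mem_univ B)
  obtain ⟨A, -, hA⟩ : ∃ A ∈ (Finset.univ : Finset 𝒜),
      c * m.likelihood B t ω / 𝒜.card ≤ m.likelihood A t ω * W D A := by
    refine Finset.exists_le_of_sum_le ⟨B, Finset.mem_univ B⟩ ?_
    rw [Finset.sum_const, Finset.card_univ, Fintype.card_coe, nsmul_eq_mul,
      mul_div_cancel₀ _ hn]
    exact (mul_le_mul_right hB c).trans hsum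
  refine ⟨A, ?_⟩
  rw [div_le_iff₀ (pos_iff_ne_zero.2 hn)] at hA
  change m.likelihood B t ω ≤ 𝒜.card * W D A / c * m.likelihood A t ω
  rw [div_mul_eq_mul_div, le_div_iff₀ (pos_iff_ne_zero.2 hc)]
  calc m.likelihood B t ω * c = c * m.likelihood B t ω := mul_comm _ _
    _ ≤ _ := hA
    _ = _ := by ring

/-- An upper bound for the part of Lorden's stopping time after time `j`, when the decision `D` is
taken at that time. -/
noncomputable def lordenBound (c : ℝ≥0) (W : 𝒜 → 𝒜 → ℝ≥0) (j : ℕ) (D B : 𝒜) (ω : Obs 𝒳) : ℝ≥0∞ :=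
  1 + ∑' s : ℕ, ∑ A : 𝒜,
    (m.likelihoodLe A B (𝒜.card * W D A / c) (j + (s + 1))).indicator 1 ω

theorem measurable_lordenBound (c : ℝ≥0) (W : 𝒜 → 𝒜 → ℝ≥0) (j : ℕ) (D B : 𝒜) :
    Measurable (m.lordenBound c W j D B) := by
  refine Measurable.const_add (.tsum (L := .unconditional ℕ) fun s => ?_) 1
  exact Finset.measurable_fun_sum _ fun A _ =>
    measurable_one.indicator (m.measurableSet_likelihoodLe _ _ _ _)

theorem lordenTime_le_add_lordenBound {c : ℝ≥0} (hc : c ≠ 0) (W : 𝒜 → 𝒜 → ℝ≥0) (j : ℕ) (D B : 𝒜)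
    (ω : Obs 𝒳) :
    (m.lordenTime c W ω : ℝ≥0∞) ≤ j + m.lordenBound c W j D B ω := by
  have key : ∀ n : ℕ, (n : ℕ∞) ≤ m.lordenTime c W ω →
      (n : ℝ≥0∞) ≤ j + m.lordenBound c W j D B ω := by
    intro n hn
    rcases le_total n (j + 1) with hnj | hnj
    · calc (n : ℝ≥0∞) ≤ j + 1 := by exact_mod_cast hnj
        _ ≤ _ := by unfold lordenBound; gcongr; exact le_self_add
    · have hterm : ∀ s ∈ Finset.range (n - (j + 1)), (1 : ℝ≥0∞) ≤ ∑ A : 𝒜,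
          (m.likelihoodLe A B (𝒜.card * W D A / c) (j + (s + 1))).indicator 1 ω := by
        intro s hs
        rw [Finset.mem_range] at hs
        have hloss : c ≤ m.posteriorLoss W (j + (s + 1)) ω D := by
          by_contra hlt
          have hle : m.lordenTime c W ω ≤ (j + (s + 1) : ℕ) :=
            sInf_le ⟨_, rfl, by omega, D, by exact_mod_cast not_le.1 hlt⟩
          have := Nat.cast_le.1 (hn.trans hle)
          omega
        obtain ⟨A, hA⟩ := m.exists_likelihood_le_of_le_posteriorLoss hc hloss B
        refine le_trans ?_ (Finset.single_le_sum (fun _ _ => zero_le) (Finset.mem_univ A))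
        rw [Set.indicator_of_mem hA, Pi.one_apply]
      calc (n : ℝ≥0∞) = j + (1 + ∑ s ∈ Finset.range (n - (j + 1)), 1) := by
            rw [Finset.sum_const, Finset.card_range, nsmul_eq_mul, mul_one]
            exact_mod_cast (by omega : n = j + (1 + (n - (j + 1))))
        _ ≤ _ := by
            unfold lordenBound
            gcongr
            exact (Finset.sum_le_sum hterm).trans (ENNReal.sum_le_tsum _)
  rcases eq_or_ne (m.lordenTime c W ω) ⊤ with h | h
  · rw [h] at key ⊢
    exact (ENNReal.eq_top_of_forall_nnreal_le fun r => by
      obtain ⟨n, hn⟩ := exists_nat_ge r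
      exact le_trans (by exact_mod_cast hn) (key n le_top)).ge
  · lift m.lordenTime c W ω to ℕ using h with n
    simpa using key n le_rfl

theorem setLIntegral_lordenBound_le (c : ℝ≥0) (W : 𝒜 → 𝒜 → ℝ≥0) {j : ℕ} (D B : 𝒜)
    (hDB : W D B = 0) {E : Set (Obs 𝒳)} (hE : MeasurableSet[obsFiltration 𝒳 j] E) {κ : ℝ≥0}
    (hκ : ∀ A B : 𝒜, A ≠ B →
      (1 - affinity (Measure.pi m.μ) (m.density A) (m.density B))⁻¹ ≤ κ)
    {p : 𝒜 → ℝ≥0} (hp : ∀ A, 𝒜.card * W D A / c ≤ p A * p B) :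
    ∫⁻ ω in E, m.lordenBound c W j D B ω ∂(m.law B)
      ≤ m.law B E + ∑ A : 𝒜, κ * (p A * m.law A E + p B * m.law B E) := by
  have hEm : MeasurableSet E := (obsFiltration 𝒳).le j E hE
  have hmeas : ∀ s : ℕ, ∀ A : 𝒜, Measurable
      ((m.likelihoodLe A B (𝒜.card * W D A / c) (j + (s + 1))).indicator
        (1 : Obs 𝒳 → ℝ≥0∞)) :=
    fun s A => measurable_one.indicator (m.measurableSet_likelihoodLe _ _ _ _)
  unfold lordenBound
  rw [lintegral_add_left measurable_const, setLIntegral_one,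
    lintegral_tsum fun s => (Finset.measurable_fun_sum _ fun A _ => hmeas s A).aemeasurable]
  simp_rw [lintegral_finsetSum _ fun A _ => hmeas _ A]
  rw [Summable.tsum_finsetSum fun _ _ => ENNReal.summable]
  gcongr with A
  simp_rw [lintegral_indicator_one (m.measurableSet_likelihoodLe _ _ _ _),
    Measure.restrict_apply (m.measurableSet_likelihoodLe _ _ _ _), Set.inter_comm _ E]
  rcases eq_or_ne A B with rfl | hAB
  · refine (ENNReal.tsum_eq_zero.2 fun s => ?_).trans_le zero_le
    refine le_antisymm ((m.law_inter_likelihoodLe_le A A (s + 1) hE (p := 0) (q := 0)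
      (by simp [hDB])).trans_eq (by simp)) zero_le
  · refine (m.tsum_law_inter_likelihoodLe_le A B hE (hp A)).trans ?_
    gcongr
    exact hκ A B hAB

variable {m}

theorem MomentAssumption.exists_affinity_bound (hm : m.MomentAssumption) :
    ∃ κ : ℝ≥0, 0 < κ ∧ ∀ A B : 𝒜, A ≠ B →
      (1 - affinity (Measure.pi m.μ) (m.density A) (m.density B))⁻¹ ≤ κ := by
  set g : 𝒜 × 𝒜 → ℝ≥0∞ := fun x =>
    (1 - affinity (Measure.pi m.μ) (m.density x.1) (m.density x.2))⁻¹ with hg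
  refine ⟨1 + ∑ x, (g x).toNNReal, by positivity, fun A B hAB => ?_⟩
  have hlt := hm.affinity_density_lt_one fun h => hAB (Subtype.ext h)
  have htop : g (A, B) ≠ ∞ := ENNReal.inv_ne_top.2 (tsub_pos_of_lt hlt).ne'
  calc g (A, B) = ((g (A, B)).toNNReal : ℝ≥0∞) := (ENNReal.coe_toNNReal htop).symm
    _ ≤ _ := ENNReal.coe_le_coe.2 <| (Finset.single_le_sum
      (f := fun x => (g x).toNNReal) (fun _ _ => zero_le) (Finset.mem_univ (A, B))).trans
        le_add_self

/-- If a decision `d` has been taken on an event of the σ-field at time `j`, then the expected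
remaining time until Lorden's stopping time is, on average, at most a constant plus the error loss
in units of `c`. -/
theorem MomentAssumption.exists_sum_setLIntegral_lordenBound_le (hm : m.MomentAssumption)
    (W : 𝒜 → 𝒜 → ℝ≥0) (hW₀ : ∀ A, W A A = 0) :
    ∃ C : ℝ≥0, ∀ c : ℝ≥0, c ≠ 0 → ∀ d : 𝒜, ∃ D : 𝒜 → 𝒜, ∀ (j : ℕ) (E : Set (Obs 𝒳)),
      MeasurableSet[obsFiltration 𝒳 j] E →
      ∑ B : 𝒜, ∫⁻ ω in E, m.lordenBound c W j (D B) B ω ∂(m.law B)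
        ≤ ∑ A : 𝒜, (C + W d A / c : ℝ≥0) * m.law A E := by
  obtain ⟨κ, hκ0, hκ⟩ := hm.exists_affinity_bound (𝒜 := 𝒜)
  set n : ℝ≥0 := (𝒜.card : ℝ≥0) with hn
  set H : ℝ≥0 := ∑ x : 𝒜 × 𝒜 × 𝒜, W x.2.1 x.1 / W x.2.2 x.2.1 with hH
  set L : ℝ≥0 := n * (1 + H) * (2 * n * κ) with hL
  refine ⟨1 + 2 * n * κ * L, fun c hc d => ?_⟩
  have hn0 : n ≠ 0 := by
    rw [hn]; exact_mod_cast (Finset.card_pos.2 ⟨d.1, d.2⟩).ne'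
  set p : 𝒜 → ℝ≥0 := fun A => W d A / c / (2 * n * κ) + L with hp
  classical
  refine ⟨fun B => if W d B = 0 then d else B, fun j E hE => ?_⟩
  have hpq : ∀ A B : 𝒜, n * W (if W d B = 0 then d else B) A / c ≤ p A * p B := by
    intro A B
    split_ifs with hB
    · calc n * W d A / c = (W d A / c / (2 * n * κ)) * (n * (1 + 0) * (2 * n * κ)) := by
            field_simp; ring
        _ ≤ p A * p B := by
            refine mul_le_mul' le_self_add (le_trans ?_ le_add_self)
            rw [hL]; gcongr; exact zero_le
    · have hHB : W B A / W d B ≤ H :=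
        Finset.single_le_sum (f := fun x : 𝒜 × 𝒜 × 𝒜 => W x.2.1 x.1 / W x.2.2 x.2.1)
          (fun _ _ => zero_le) (Finset.mem_univ (A, B, d))
      calc n * W B A / c = n * (W B A / W d B) * (2 * n * κ) * (W d B / c / (2 * n * κ)) := by
            field_simp
        _ ≤ p A * p B := by
            refine mul_le_mul' (le_trans ?_ le_add_self) le_self_add
            rw [hL]; gcongr; exact hHB.trans le_add_self
  calc ∑ B : 𝒜, ∫⁻ ω in E, m.lordenBound c W j (if W d B = 0 then d else B) B ω ∂(m.law B)
      ≤ ∑ B : 𝒜, (m.law B E + ∑ A : 𝒜, κ * (p A * m.law A E + p B * m.law B E)) := by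
        refine Finset.sum_le_sum fun B _ => ?_
        refine m.setLIntegral_lordenBound_le c W _ B ?_ hE hκ fun A => hpq A B
        split_ifs with hB
        exacts [hB, hW₀ B]
    _ = ∑ A : 𝒜, (1 + 2 * n * κ * p A : ℝ≥0) * m.law A E := by
        simp_rw [mul_add, Finset.sum_add_distrib, Finset.sum_const, Finset.card_univ,
          Fintype.card_coe, ← Finset.smul_sum, nsmul_eq_mul]
        push_cast
        simp_rw [add_mul, one_mul, Finset.sum_add_distrib, Finset.mul_sum]
        rw [hn, ← Finset.sum_add_distrib]
        congr 1
        refine Finset.sum_congr rfl fun A _ => ?_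
        push_cast
        ring
    _ = ∑ A : 𝒜, (1 + 2 * n * κ * L + W d A / c : ℝ≥0) * m.law A E := by
        refine Finset.sum_congr rfl fun A _ => ?_
        congr 2
        rw [hp]
        field_simp
        ring

theorem card_mul_integratedError (δ : Procedure 𝒳 𝒜) (W : 𝒜 → 𝒜 → ℝ≥0) :
    𝒜.card * m.integratedError δ W
      = ∑ A : 𝒜, ∑ d : 𝒜, (m.law A).real {ω | δ.D ω = d} * (W d A : ℝ) := by
  rw [integratedError, ← Finset.mul_sum, ← mul_assoc]
  rcases 𝒜.eq_empty_or_nonempty with rfl | h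
  · simp
  · have : (𝒜.card : ℝ) ≠ 0 := by exact_mod_cast h.card_pos.ne'
    rw [mul_one_div_cancel this, one_mul]

theorem _root_.SeqTest.Procedure.measurableSet_eq_inter_eq (δ : Procedure 𝒳 𝒜) (j : ℕ) (d : 𝒜) :
    MeasurableSet[obsFiltration 𝒳 j] ({ω | δ.D ω = d} ∩ {ω | δ.T ω = j}) := by
  have h := (IsStoppingTime.measurableSet_inter_eq_iff δ.isStoppingTime {ω | δ.D ω = d} j).1
    (MeasurableSet.inter (δ.measurable_D d)
      (δ.isStoppingTime.measurableSet_eq_of_countable' j))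
  exact h

/-- Lorden's stopping time exceeds, in expectation, the sample size of any procedure by at most a
constant plus the error loss in units of `c`. -/
theorem MomentAssumption.exists_lintegral_lordenTime_le (hm : m.MomentAssumption)
    (W : 𝒜 → 𝒜 → ℝ≥0) (hW₀ : ∀ A, W A A = 0) :
    ∃ C : ℝ≥0, ∀ c : ℝ≥0, c ≠ 0 → ∀ A : 𝒜,
      ∫⁻ ω, (m.lordenTime c W ω : ℝ≥0∞) ∂(m.law A) < ∞ ∧ ∀ δ : Procedure 𝒳 𝒜,
      ∫⁻ ω, (m.lordenTime c W ω : ℝ≥0∞) ∂(m.law A)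
        ≤ m.ess A δ + ENNReal.ofReal (𝒜.card * (C + m.integratedError δ W / c)) := by
  obtain ⟨C, hC⟩ := hm.exists_sum_setLIntegral_lordenBound_le W hW₀
  refine ⟨𝒜.card * C, fun c hc A => ⟨?_, fun δ => ?_⟩⟩
  · obtain ⟨D, hD⟩ := hC c hc A
    have h := hD 0 Set.univ MeasurableSet.univ
    simp only [Measure.restrict_univ, measure_univ, mul_one] at h
    calc ∫⁻ ω, (m.lordenTime c W ω : ℝ≥0∞) ∂(m.law A)
        ≤ ∫⁻ ω, m.lordenBound c W 0 (D A) A ω ∂(m.law A) := by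
          refine lintegral_mono fun ω => ?_
          simpa using m.lordenTime_le_add_lordenBound hc W 0 (D A) A ω
      _ ≤ ∑ B : 𝒜, ∫⁻ ω, m.lordenBound c W 0 (D B) B ω ∂(m.law B) :=
          Finset.single_le_sum
            (f := fun B : 𝒜 => ∫⁻ ω, m.lordenBound c W 0 (D B) B ω ∂(m.law B))
            (fun _ _ => zero_le) (Finset.mem_univ A)
      _ ≤ _ := h
      _ < ∞ := by
          rw [← ENNReal.ofNNReal_finsetSum]
          exact ENNReal.coe_lt_top
  · choose D hD using hC c hc
    set E : ℕ → 𝒜 → Set (Obs 𝒳) := fun j d => {ω | δ.D ω = d} ∩ {ω | δ.T ω = j} with hE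
    have hEm : ∀ j d, MeasurableSet[obsFiltration 𝒳 j] (E j d) := δ.measurableSet_eq_inter_eq
    have hEm' : ∀ j d, MeasurableSet (E j d) := fun j d => (obsFiltration 𝒳).le j _ (hEm j d)
    set U : 𝒜 → ℕ → 𝒜 → Obs 𝒳 → ℝ≥0∞ := fun B j d =>
      (E j d).indicator (m.lordenBound c W j (D d B) B) with hU
    have hUm : ∀ B j d, Measurable (U B j d) := fun B j d =>
      (m.measurable_lordenBound c W j (D d B) B).indicator (hEm' j d)
    have hpoint : ∀ ω, (m.lordenTime c W ω : ℝ≥0∞)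
        ≤ (δ.T ω : ℝ≥0∞) + ∑' j, ∑ d, U A j d ω := by
      intro ω
      rcases eq_or_ne (δ.T ω) ⊤ with htop | htop
      · simp [htop]
      · obtain ⟨j, hj⟩ := ENat.ne_top_iff_exists.1 htop
        have hmem : ω ∈ E j (δ.D ω) := ⟨rfl, hj.symm⟩
        calc (m.lordenTime c W ω : ℝ≥0∞)
            ≤ j + m.lordenBound c W j (D (δ.D ω) A) A ω :=
              m.lordenTime_le_add_lordenBound hc W j _ A ω
          _ = (δ.T ω : ℝ≥0∞) + U A j (δ.D ω) ω := by
              rw [hU, ← hj]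
              simp only [Set.indicator_of_mem hmem, ENat.toENNReal_coe]
          _ ≤ _ := by
              gcongr
              exact (Finset.single_le_sum (f := fun d => U A j d ω) (fun _ _ => zero_le)
                (Finset.mem_univ _)).trans (ENNReal.le_tsum j)
    have hsum_E : ∀ (B d : 𝒜), ∑' j, m.law B (E j d) ≤ m.law B {ω | δ.D ω = d} := by
      intro B d
      rw [← measure_iUnion (fun i j hij => Set.disjoint_left.2 fun ω hi hj =>
        hij (Nat.cast_injective (hi.2.symm.trans hj.2 : (i : ℕ∞) = j))) fun j => hEm' j d]
      exact measure_mono (Set.iUnion_subset fun j => Set.inter_subset_left)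
    calc ∫⁻ ω, (m.lordenTime c W ω : ℝ≥0∞) ∂(m.law A)
        ≤ ∫⁻ ω, ((δ.T ω : ℝ≥0∞) + ∑' j, ∑ d, U A j d ω) ∂(m.law A) := lintegral_mono hpoint
      _ = m.ess A δ + ∑ d, ∑' j, ∫⁻ ω, U A j d ω ∂(m.law A) := by
          rw [lintegral_add_right _ (.tsum (L := .unconditional ℕ) fun j =>
              Finset.measurable_fun_sum _ fun d _ => hUm A j d),
            lintegral_tsum fun j =>
              (Finset.measurable_fun_sum _ fun d _ => hUm A j d).aemeasurable]
          simp_rw [lintegral_finsetSum _ fun d _ => hUm A _ d]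
          rw [Summable.tsum_finsetSum fun _ _ => ENNReal.summable, ess]
      _ ≤ m.ess A δ + ∑ d, ∑' j, ∑ B : 𝒜, ∫⁻ ω, U B j d ω ∂(m.law B) := by
          gcongr with d _ j
          exact Finset.single_le_sum (f := fun B : 𝒜 => ∫⁻ ω, U B j d ω ∂(m.law B))
            (fun _ _ => zero_le) (Finset.mem_univ A)
      _ ≤ m.ess A δ + ∑ d, ∑' j, ∑ B : 𝒜, (C + W d B / c : ℝ≥0) * m.law B (E j d) := by
          refine add_le_add_right (Finset.sum_le_sum fun d _ => ENNReal.tsum_le_tsum fun j => ?_) _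
          simp_rw [hU, lintegral_indicator (hEm' j d)]
          exact hD d j (E j d) (hEm j d)
      _ ≤ m.ess A δ + ∑ d, ∑ B : 𝒜, (C + W d B / c : ℝ≥0) * m.law B {ω | δ.D ω = d} := by
          gcongr with d
          rw [Summable.tsum_finsetSum fun _ _ => ENNReal.summable]
          gcongr with B
          rw [ENNReal.tsum_mul_left]
          gcongr
          exact hsum_E B d
      _ = m.ess A δ + ENNReal.ofReal
            (∑ d, ∑ B : 𝒜, (C + W d B / c) * (m.law B).real {ω | δ.D ω = d}) := by
          rw [ENNReal.ofReal_sum_of_nonneg fun d _ => Finset.sum_nonneg fun B _ => by positivity]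
          congr 1
          refine Finset.sum_congr rfl fun d _ => ?_
          rw [ENNReal.ofReal_sum_of_nonneg fun B _ => by positivity]
          refine Finset.sum_congr rfl fun B _ => ?_
          rw [ENNReal.ofReal_mul (by positivity), ofReal_measureReal]
          congr 1
          rw [← ENNReal.ofReal_coe_nnreal]
          push_cast
          rfl
      _ ≤ _ := by
          gcongr
          have hcR : (c : ℝ) ≠ 0 := by exact_mod_cast hc
          calc ∑ d, ∑ B : 𝒜, ((C : ℝ) + W d B / c) * (m.law B).real {ω | δ.D ω = d}
              = ∑ d, ∑ B : 𝒜, C * (m.law B).real {ω | δ.D ω = d}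
                + (𝒜.card * m.integratedError δ W) / c := by
                rw [card_mul_integratedError,
                  Finset.sum_comm (f := fun B d : 𝒜 => _ * (W d B : ℝ)), Finset.sum_div,
                  ← Finset.sum_add_distrib]
                refine Finset.sum_congr rfl fun d _ => ?_
                rw [Finset.sum_div, ← Finset.sum_add_distrib]
                refine Finset.sum_congr rfl fun B _ => ?_
                ring
            _ ≤ ∑ _d : 𝒜, ∑ _B : 𝒜, (C : ℝ) * 1 + (𝒜.card * m.integratedError δ W) / c := by
                gcongr
                exact measureReal_le_one
            _ = _ := by
                simp only [Finset.sum_const, Finset.card_univ, Fintype.card_coe, nsmul_eq_mul]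
                push_cast
                ring

theorem MomentAssumption.exists_ess_le_minEss_add (hm : m.MomentAssumption)
    (W : 𝒜 → 𝒜 → ℝ≥0) (hW₀ : ∀ A, W A A = 0) :
    ∃ C : ℝ≥0, ∀ c : ℝ, 0 < c → ∀ (A : 𝒜) (δ₀ : Procedure 𝒳 𝒜) (Δ : Set (Procedure 𝒳 𝒜)) (L : ℝ),
      (∀ᵐ ω ∂(m.law A), δ₀.T ω ≤ m.lordenTime c W ω) →
      (∀ δ ∈ Δ, m.integratedError δ W ≤ L * c) →
      m.ess A δ₀ < ∞ ∧ m.ess A δ₀ ≤ m.minEss A Δ + ENNReal.ofReal ((L + C) * 𝒜.card) := by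
  obtain ⟨C, hC⟩ := hm.exists_lintegral_lordenTime_le W hW₀
  refine ⟨C, fun c hc A δ₀ Δ L hT hL => ?_⟩
  lift c to ℝ≥0 using hc.le
  have hc0 : c ≠ 0 := by rintro rfl; simp at hc
  have hle : m.ess A δ₀ ≤ ∫⁻ ω, (m.lordenTime c W ω : ℝ≥0∞) ∂(m.law A) :=
    lintegral_mono_ae (hT.mono fun ω hω => ENat.toENNReal_le.2 hω)
  refine ⟨hle.trans_lt (hC c hc0 A).1, ?_⟩
  rw [minEss, ENNReal.iInf_add]
  refine le_iInf fun δ => ?_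
  rw [ENNReal.iInf_add]
  refine le_iInf fun hδ => (hle.trans ((hC c hc0 A).2 δ)).trans ?_
  refine add_le_add le_rfl (ENNReal.ofReal_le_ofReal ?_)
  have : m.integratedError δ W / c ≤ L := (div_le_iff₀ hc).2 (hL δ hδ)
  rw [mul_comm]
  exact mul_le_mul_of_nonneg_right (by linarith) (Nat.cast_nonneg _)

end Model

end SeqTest

theorem mainTheorem1 {K : ℕ} {𝒳 : Fin K → Type*} [∀ k, MeasurableSpace (𝒳 k)]
    (m : SeqTest.Model K 𝒳) (hm : m.MomentAssumption)
    (𝒜 : Finset (Finset (Fin K)))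
    (W : 𝒜 → 𝒜 → ℝ≥0) (hW₀ : ∀ A, W A A = 0) (hW : ∀ D, ∃ A, 0 < W D A) :
    ∃ M : ℝ, 0 < M ∧
      ∀ (r : ℕ) (Δ : (Fin r → ℝ) → Set (SeqTest.Procedure 𝒳 𝒜))
        (δ₀ : (Fin r → ℝ) → SeqTest.Procedure 𝒳 𝒜) (c : (Fin r → ℝ) → ℝ) (L : ℝ),
        (∀ θ ∈ SeqTest.tolerances r, δ₀ θ ∈ Δ θ) →
        (∀ θ ∈ SeqTest.tolerances r, 0 < c θ) → 0 < L →
        (∀ A : 𝒜, ∀ θ ∈ SeqTest.tolerances r,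
          ∀ᵐ ω ∂(m.law A), (δ₀ θ).T ω ≤ m.lordenTime (c θ) W ω) →
        (∀ θ ∈ SeqTest.tolerances r, ∀ δ ∈ Δ θ, m.integratedError δ W ≤ L * c θ) →
        (∀ A : 𝒜, ∀ θ ∈ SeqTest.tolerances r, m.ess A (δ₀ θ) < ∞ ∧
          (m.ess A (δ₀ θ)).toReal - (m.minEss A (Δ θ)).toReal ≤ (2 * L + M) * (𝒜.card : ℝ)) ∧
        SeqTest.IsSecondOrderOptimal m Δ δ₀ := by
  obtain ⟨C, hC⟩ := hm.exists_ess_le_minEss_add W hW₀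
  refine ⟨C + 1, by positivity, fun r Δ δ₀ c L hmem hc hL hT herr => ?_⟩
  have key : ∀ A : 𝒜, ∀ θ ∈ SeqTest.tolerances r, m.ess A (δ₀ θ) < ∞ ∧
      m.ess A (δ₀ θ) ≤ m.minEss A (Δ θ) + ENNReal.ofReal ((L + C) * 𝒜.card) :=
    fun A θ hθ => hC (c θ) (hc θ hθ) A (δ₀ θ) (Δ θ) L (hT A θ hθ) (herr θ hθ)
  have hreal : ∀ A : 𝒜, ∀ θ ∈ SeqTest.tolerances r,
      (m.ess A (δ₀ θ)).toReal - (m.minEss A (Δ θ)).toReal ≤ (2 * L + (C + 1)) * (𝒜.card : ℝ) := by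
    intro A θ hθ
    obtain ⟨hfin, hle⟩ := key A θ hθ
    have hmin : m.minEss A (Δ θ) ≠ ∞ := ((iInf₂_le _ (hmem θ hθ)).trans_lt hfin).ne
    have h := ENNReal.toReal_mono (ENNReal.add_ne_top.2 ⟨hmin, ENNReal.ofReal_ne_top⟩) hle
    rw [ENNReal.toReal_add hmin ENNReal.ofReal_ne_top, ENNReal.toReal_ofReal (by positivity)] at h
    have : (L + C) * (𝒜.card : ℝ) ≤ (2 * L + (C + 1)) * 𝒜.card := by gcongr <;> linarith
    linarith
  refine ⟨fun A θ hθ => ⟨(key A θ hθ).1, hreal A θ hθ⟩, hmem, fun A => ⟨?_, ?_⟩⟩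
  · filter_upwards [self_mem_nhdsWithin] with θ hθ using (key A θ hθ).1
  · refine (limsup_le_of_le
      (a := (((2 * L + (C + 1)) * (𝒜.card : ℝ) : ℝ) : EReal)) (by isBoundedDefault) ?_).trans_lt
        (EReal.coe_lt_top _)
    filter_upwards [self_mem_nhdsWithin] with θ hθ
    have hmin : m.minEss A (Δ θ) ≠ ∞ := ((iInf₂_le _ (hmem θ hθ)).trans_lt (key A θ hθ).1).ne
    rw [← EReal.coe_ennreal_toReal (key A θ hθ).1.ne, ← EReal.coe_ennreal_toReal hmin,
      ← EReal.coe_sub]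
    exact EReal.coe_le_coe_iff.2 (hreal A θ hθ)
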